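/- **Theorem (a-posteriori guarantees for convex robust storage planning, (c-RSP)).** *Model.* Let $\mathcal N$ (buses), $\mathcal G$ (generators; $\mathcal G(n)$ are those at bus $n$), $\mathcal L$ (lines $l$ from $o(l)$ to $r(l)$) be finite sets and $\mathcal T=\{1,\dots,H\}$. A scenario is $\delta=(\alpha^w_{n,t},\alpha^d_{n,t})_{n\in\mathcal N,t\in\mathcal T}$. A plan is $x=(E_n,P_n)_{n\in\mathcal N}$. The set $\breve\Xi_1$ consists of the plans with $\sum_n(C^{\rm E}_nE_n+C^{\rm P}_nP_n)\le C^{\rm budget}$ and $\underline\rho E_n\le P_n\le\overline\rho E_n$ for all $n$ and, in the variant with units of fixed size, such that moreover there are real $z_n$ with $\sum_n z_n\le\overline z$, $q^{\rm E}z_n=E_n$, $q^{\rm P}z_n=P_n$. The set $\breve\Xi_2(x;\delta)$ consists of all real $y=(p^{\rm ch}_{n,t},p^{\rm dis}_{n,t},v_{n,t},e_{n,t},p^{\rm shed}_{n,t},p^{\mathcal G}_{i,t},p^{\mathcal L}_{l,t},\theta_{n,t})$ with, for all indices, $$0\le p^{\rm ch}_{n,t}\le P_nv_{n,t},\quad 0\le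 p^{\rm dis}_{n,t}\le P_n(1-v_{n,t}),\quad 0\le v_{n,t}\le1,\quad 0\le e_{n,t}\le E_n,$$ $$e_{n,t}-e_{n,t-1}=\eta^{\rm ch}_np^{\rm ch}_{n,t}-p^{\rm dis}_{n,t}/\eta^{\rm dis}_n,\qquad -\underline R_i\le p^{\mathcal G}_{i,t}-p^{\mathcal G}_{i,t-1}\le\overline R_i\qquad(2\le t\le H),$$ $$\sum_{i\in\mathcal G(n)}p^{\mathcal G}_{i,t}+p^{\rm dis}_{n,t}-p^{\rm ch}_{n,t}+\alpha^w_{n,t}\overline w_n+\sum_{l:r(l)=n}p^{\mathcal L}_{l,t}-\sum_{l:o(l)=n}p^{\mathcal L}_{l,t}+p^{\rm shed}_{n,t}=\alpha^d_{n,t}\overline d_n,$$ $$\underline{p^{\mathcal G}_i}\le p^{\mathcal G}_{i,t}\le\overline{p^{\mathcal G}_i},\quad \underline{p^{\mathcal L}_l}\le p^{\mathcal L}_{l,t}\le\overline{p^{\mathcal L}_l},\quad 0\le p^{\rm shed}_{n,t}\le\alpha^d_{n,t}\overline d_n,\quad p^{\mathcal L}_{l,t}=\tfrac1{x_l}(\theta_{o(l),t}-\theta_{r(l),t}),$$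 where all parameters are real, $\eta^{\rm ch}_n,\eta^{\rm dis}_n>0$ and the reactances $x_l$ are nonzero. The costs are either (cost-minimizing) $C(x)=\sum_n(C^{\rm E}_nE_n+C^{\rm P}_nP_n)$ and $c(y)=\sum_t\sum_n\big(\sum_{i\in\mathcal G(n)}c^{\mathcal G}_ip^{\mathcal G}_{i,t}+c^{\rm ch}_np^{\rm ch}_{n,t}+c^{\rm dis}_np^{\rm dis}_{n,t}+c^{\rm shed}_np^{\rm shed}_{n,t}\big)$, or (curtailment-minimizing) $C(x)=0$ and $c(y)=\sum_t\sum_np^{\rm shed}_{n,t}$. Let $K_d>0$. *Problem.* For scenarios $\delta^{(1)},\dots,\delta^{(K)}$ and $J\subseteq\{1,\dots,K\}$ consider $$\min_{x\in\breve\Xi_1}\ C(x)+K_d\max_{i\in J}\ \min_{y\in\breve\Xi_2(x;\delta^{(i)})}c(y),\qquad\text{(c-RSP)}_J$$ where the inner minimum is $+\infty$ if $\breve\Xi_2(x;\delta^{(i)})=\emptyset$. An optimal solution of (c-RSP)$_J$ is a pair $(x_J^*,\gamma_J^*)$ of a minimizer $x_J^*$ and its finite worst-case cost $\gamma_J^*=\max_{i\in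 J}\min_{y}c(y)\in\mathbb R$. A set $I\subseteq\{1,\dots,K\}$ is *invariant* if (c-RSP)$_I$ and (c-RSP)$_{\{1,\dots,K\}}$ have optimal solutions with $C(x_I^*)+K_d\gamma_I^*=C(x_{\mathcal K}^*)+K_d\gamma_{\mathcal K}^*$, where $\mathcal K=\{1,\dots,K\}$. With $\mathcal Z(\delta)=\{(x,\gamma):\exists y\in\breve\Xi_2(x;\delta),\ c(y)\le\gamma\}$, the violation probability is $\mathbb V(x,\gamma)=\mathbb P_\delta\big((x,\gamma)\notin\mathcal Z(\delta)\big)$. *Statement.* Let $\delta^{(1)},\dots,\delta^{(K)}$ be i.i.d. with law $\mathbb P_\delta$ (any Borel probability measure), let $\beta\in(0,1)$, and suppose that with probability one (c-RSP)$_J$ has exactly one optimal solution for every nonempty $J\subseteq\{1,\dots,K\}$. Then: 1. For every $k\in\{0,\dots,K-1\}$ there is exactly one $\epsilon=\epsilon(k,\beta,K)\in(0,1)$ with $$\frac{\beta}{K+1}\sum_{i=k}^K\binom ik(1-\epsilon)^{i-k}-\binom Kk(1-\epsilon)^{K-k}=0 .$$ 2. If $(x_{\mathcal K}^*,\gamma_{\mathcal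 K}^*)$ is the optimal solution with all $K$ scenarios and $I_{\mathcal K}$ is an arbitrarily chosen (sample-dependent) invariant set, then $$\mathbb P^K\Big(|I_{\mathcal K}|<K\ \text{ and }\ \mathbb V(x_{\mathcal K}^*,\gamma_{\mathcal K}^*)\ge\epsilon(|I_{\mathcal K}|,\beta,K)\Big)\le\beta ,$$ where $\mathbb P^K$ is understood as outer measure if the choice of $I_{\mathcal K}$ is not measurable. -/

import Mathlib

open MeasureTheory

noncomputable section

namespace StoragePlanning

/-- A scenario `(α^w, α^d)`: the daily profiles (hours `Fin H`) of the wind capacity factors and of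
the load factors at the buses `N`. -/
abbrev Scenario (N : Type*) (H : ℕ) : Type _ := (N → Fin H → ℝ) × (N → Fin H → ℝ)

/-- A first-stage decision `(E, P)`: energy and power ratings of the storage at each bus. -/
abbrev Plan (N : Type*) : Type _ := (N → ℝ) × (N → ℝ)

/-- Which of the two planning objectives is minimised. -/
inductive Objective
  | cost
  | curtailment

/-- Whether the ratings are free (`continuous`), or tied to a real-valued (relaxed) number of
storage units of fixed energy and power size (`units`). -/
inductive Sizing
  | continuous
  | units

/-- The data of a storage planning instance: buses `N`, generators `G`, lines `L`, hours `Fin H`. -/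
structure Network (N G L : Type*) (H : ℕ) where
  /-- the bus of a generator -/
  genBus : G → N
  /-- sending bus `o(l)` of a line -/
  sendBus : L → N
  /-- receiving bus `r(l)` of a line -/
  recvBus : L → N
  /-- line reactance -/
  reactance : L → ℝ
  reactance_ne_zero : ∀ l, reactance l ≠ 0
  flowMin : L → ℝ
  flowMax : L → ℝ
  genMin : G → ℝ
  genMax : G → ℝ
  rampDown : G → ℝ
  rampUp : G → ℝ
  /-- maximum wind capacity at a bus -/
  windCap : N → ℝ
  /-- peak load at a bus -/
  peakLoad : N → ℝ
  /-- charging efficiency -/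
  effCh : N → ℝ
  /-- discharging efficiency -/
  effDis : N → ℝ
  effCh_pos : ∀ n, 0 < effCh n
  effDis_pos : ∀ n, 0 < effDis n
  /-- investment cost per unit of energy rating -/
  costE : N → ℝ
  /-- investment cost per unit of power rating -/
  costP : N → ℝ
  costGen : G → ℝ
  costCh : N → ℝ
  costDis : N → ℝ
  costShed : N → ℝ
  budget : ℝ
  /-- minimum power/energy ratio -/
  ratioMin : ℝ
  /-- maximum power/energy ratio -/
  ratioMax : ℝ
  /-- energy rating of one storage unit -/
  unitE : ℝ
  /-- power rating of one storage unit -/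
  unitP : ℝ
  /-- bound on the total number of storage units -/
  maxUnits : ℝ
  /-- the weight `K_d` of the operational cost -/
  weight : ℝ
  weight_pos : 0 < weight
  objective : Objective
  sizing : Sizing

/-- The second-stage (operational) decision variables. -/
structure Operation (N G L : Type*) (H : ℕ) where
  /-- charging power -/
  ch : N → Fin H → ℝ
  /-- discharging power -/
  dis : N → Fin H → ℝ
  /-- (relaxed) charging indicator -/
  v : N → Fin H → ℝ
  /-- state of charge -/
  soc : N → Fin H → ℝ
  /-- load curtailment -/
  shed : N → Fin H → ℝ
  /-- generator output -/
  gen : G → Fin H → ℝ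
  /-- line flow -/
  flow : L → Fin H → ℝ
  /-- nodal voltage angle -/
  angle : N → Fin H → ℝ

variable {N G L : Type*} [Fintype N] [Fintype G] [Fintype L] [DecidableEq N] {H K : ℕ}

namespace Network

/-- The annualised cost of a plan, `∑ n, (C^E_n E_n + C^P_n P_n)`. -/
def planCost (S : Network N G L H) (x : Plan N) : ℝ :=
  ∑ n, (S.costE n * x.1 n + S.costP n * x.2 n)

/-- The first-stage term `C(x)` of the objective. -/
def firstStageCost (S : Network N G L H) (x : Plan N) : ℝ :=
  match S.objective with
  | Objective.cost => S.planCost x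
  | Objective.curtailment => 0

/-- The second-stage cost `c(y)`. -/
def operationCost (S : Network N G L H) (y : Operation N G L H) : ℝ :=
  match S.objective with
  | Objective.cost =>
      (∑ t, ∑ n, ∑ i with S.genBus i = n, S.costGen i * y.gen i t) +
      (∑ t, ∑ n, (S.costCh n * y.ch n t + S.costDis n * y.dis n t)) +
      ∑ t, ∑ n, S.costShed n * y.shed n t
  | Objective.curtailment => ∑ t, ∑ n, y.shed n t

/-- The convexified feasible set of the first stage. -/
def firstStage (S : Network N G L H) : Set (Plan N) :=
  {x | S.planCost x ≤ S.budget ∧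
    (∀ n, S.ratioMin * x.1 n ≤ x.2 n ∧ x.2 n ≤ S.ratioMax * x.1 n) ∧
    match S.sizing with
    | Sizing.continuous => True
    | Sizing.units => ∃ z : N → ℝ, ∑ n, z n ≤ S.maxUnits ∧
        ∀ n, S.unitE * z n = x.1 n ∧ S.unitP * z n = x.2 n}

/-- Storage constraints, with the charging indicator relaxed to `[0, 1]`. -/
structure StorageFeasible (S : Network N G L H) (x : Plan N) (y : Operation N G L H) : Prop where
  socEvolve : ∀ n, ∀ t t' : Fin H, (t : ℕ) + 1 = (t' : ℕ) →
    y.soc n t' - y.soc n t = y.ch n t' * S.effCh n - y.dis n t' / S.effDis n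
  charging : ∀ n t, 0 ≤ y.ch n t ∧ y.ch n t ≤ x.2 n * y.v n t
  discharging : ∀ n t, 0 ≤ y.dis n t ∧ y.dis n t ≤ x.2 n * (1 - y.v n t)
  socBounds : ∀ n t, 0 ≤ y.soc n t ∧ y.soc n t ≤ x.1 n
  relaxed : ∀ n t, 0 ≤ y.v n t ∧ y.v n t ≤ 1

/-- Constraints of the transmission system, with DC power flow. -/
structure GridFeasible (S : Network N G L H) (δ : Scenario N H) (y : Operation N G L H) :
    Prop where
  balance : ∀ n t,
    (∑ i with S.genBus i = n, y.gen i t) + y.dis n t - y.ch n t + δ.1 n t * S.windCap n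
      + (∑ l with S.recvBus l = n, y.flow l t) - (∑ l with S.sendBus l = n, y.flow l t)
      + y.shed n t = δ.2 n t * S.peakLoad n
  generation : ∀ i t, S.genMin i ≤ y.gen i t ∧ y.gen i t ≤ S.genMax i
  ramping : ∀ i, ∀ t t' : Fin H, (t : ℕ) + 1 = (t' : ℕ) →
    -S.rampDown i ≤ y.gen i t' - y.gen i t ∧ y.gen i t' - y.gen i t ≤ S.rampUp i
  flowBounds : ∀ l t, S.flowMin l ≤ y.flow l t ∧ y.flow l t ≤ S.flowMax l
  shedding : ∀ n t, 0 ≤ y.shed n t ∧ y.shed n t ≤ δ.2 n t * S.peakLoad n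
  dcFlow : ∀ l t,
    y.flow l t = 1 / S.reactance l * (y.angle (S.sendBus l) t - y.angle (S.recvBus l) t)

/-- The convexified feasible set of the second stage. -/
def secondStage (S : Network N G L H) (x : Plan N) (δ : Scenario N H) :
    Set (Operation N G L H) :=
  {y | S.StorageFeasible x y ∧ S.GridFeasible δ y}

/-- `min_{y} c(y)` over the second-stage feasible set; it is `⊤` if that set is empty. -/
def recourseCost (S : Network N G L H) (x : Plan N) (δ : Scenario N H) : EReal :=
  ⨅ y ∈ S.secondStage x δ, (S.operationCost y : EReal)

/-- `max_{i ∈ J} min_{y} c(y)`, the worst case over the scenarios with index in `J`. -/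
def worstCost (S : Network N G L H) (ω : Fin K → Scenario N H) (J : Finset (Fin K))
    (x : Plan N) : EReal :=
  ⨆ i ∈ J, S.recourseCost x (ω i)

/-- The objective `C(x) + K_d max_{i ∈ J} min_{y} c(y)` of the two-stage robust problem. -/
def totalCost (S : Network N G L H) (ω : Fin K → Scenario N H) (J : Finset (Fin K))
    (x : Plan N) : EReal :=
  (S.firstStageCost x : EReal) + (S.weight : EReal) * S.worstCost ω J x

/-- `s = (x*, γ*)` is an optimal solution of the two-stage problem whose uncertainty set consists of
the scenarios with index in `J`: `x*` is an optimal plan, `γ*` its (finite) worst-case cost. -/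
structure IsOptimal (S : Network N G L H) (ω : Fin K → Scenario N H) (J : Finset (Fin K))
    (s : Plan N × ℝ) : Prop where
  mem : s.1 ∈ S.firstStage
  worst : S.worstCost ω J s.1 = (s.2 : EReal)
  minimal : ∀ x ∈ S.firstStage, S.totalCost ω J s.1 ≤ S.totalCost ω J x

/-- The objective value `C(x) + K_d γ` of a pair `(x, γ)`. -/
def value (S : Network N G L H) (s : Plan N × ℝ) : ℝ :=
  S.firstStageCost s.1 + S.weight * s.2

/-- The scenarios with index in `I` form an invariant set: the problems with the scenarios in `I`
and with all scenarios have the same optimal value. -/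
def IsInvariant (S : Network N G L H) (ω : Fin K → Scenario N H) (I : Finset (Fin K)) : Prop :=
  ∃ s s' : Plan N × ℝ, S.IsOptimal ω I s ∧ S.IsOptimal ω Finset.univ s' ∧ S.value s = S.value s'

/-- The set `Z(δ)` of the pairs `(x, γ)` for which the second stage has a feasible operation
of cost at most `γ`. -/
def robustSet (S : Network N G L H) (δ : Scenario N H) : Set (Plan N × ℝ) :=
  {s | ∃ y ∈ S.secondStage s.1 δ, S.operationCost y ≤ s.2}

/-- The violation probability of `(x, γ)`. -/
def violationProb (S : Network N G L H) (μ : Measure (Scenario N H)) (s : Plan N × ℝ) : ℝ :=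
  μ.real {δ | s ∉ S.robustSet δ}

end Network

/-- The wait-and-judge polynomial. -/
def waitJudge (k : ℕ) (β : ℝ) (K : ℕ) (e : ℝ) : ℝ :=
  β / (K + 1) * (∑ i ∈ Finset.Icc k K, (i.choose k : ℝ) * (1 - e) ^ (i - k))
    - (K.choose k : ℝ) * (1 - e) ^ (K - k)

end StoragePlanning

end

/-!
The argument does not use convexity. It rests on the fact that the optimal value of the robust
problem, `Network.optValue`, is a monotone function of the set of scenarios, and that, solutions
being unique, a new scenario whose set `Z(δ)` misses the current solution changes this value
(`Network.violationProb_le_changeProb`).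

For a sample `A`, spread unit mass evenly over the invariant sub-samples `J ⊆ A` of smallest
cardinality (`share`). This makes a tie-breaking rule, and with it any nondegeneracy assumption,
unnecessary. When `A` grows by one point, the share of `J` cannot grow, and it is lost if the new
point changes the optimal value of `J` (`share_insert_le`). Hence the expected share of `J`, counted
only where the change probability of `J` is at least `ε J.card`, decays at least geometrically with
ratio `1 - ε J.card` as `A` grows (`lintegral_riskyShare_insert_le`, by Fubini in one coordinate).
The total mass is at most one for every `A`. Averaging these constraints with the weights
`1 / ((K + 1) * K.choose A.card)` and counting the `A` between `J` and the full sample produces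
exactly the sum in the wait-and-judge equation, so the risky mass of the full sample is at most `β`
(`sum_le_of_geometric_decay`, `measure_minInvariant_risky_le`).

The link to the planning problem needs three facts. The optimal value is Borel in the sample,
because its sublevel sets are countable unions of projections of closed subsets of
finite-dimensional spaces, and so σ-compact (`Network.measurable_optValue`). The second-stage
minimum is attained, because the operations are bounded up to the voltage angles, which depend
continuously on the flows after a suitable choice (`Network.recourseCost_le_iff`).
Finally, the solutions `ε k` of the equation increase with `k` (`waitJudge_root_mono`), so
that an arbitrary invariant set may be replaced by a smallest one; both this and the unique
solvability follow by writing the equation in the variable `(1 - e)⁻¹`, in which it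
has nonnegative coefficients.
-/

namespace StoragePlanning

/-! ### The wait-and-judge equation -/

/-- The sum `∑ i ≤ K, (i choose k) u ^ (K - i)`, which turns the equation `waitJudge k β K e = 0`
into `β / (K + 1) * judgeSum k K (1 - e)⁻¹ = K.choose k`. -/
def judgeSum (k K : ℕ) (u : ℝ) : ℝ := ∑ i ∈ Finset.range (K + 1), (i.choose k : ℝ) * u ^ (K - i)

lemma waitJudge_eq_mul {k K : ℕ} (hk : k ≤ K) (β : ℝ) {e : ℝ} (he : e < 1) :
    waitJudge k β K e =
      (1 - e) ^ (K - k) * (β / (K + 1) * judgeSum k K (1 - e)⁻¹ - K.choose k) := by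
  have ht : (1 - e) ≠ 0 := by linarith
  have hsum : ∑ i ∈ Finset.Icc k K, (i.choose k : ℝ) * (1 - e) ^ (i - k) =
      (1 - e) ^ (K - k) * judgeSum k K (1 - e)⁻¹ := by
    rw [judgeSum, Finset.mul_sum]
    have hsub : Finset.Icc k K ⊆ Finset.range (K + 1) := fun i hi => by
      simp only [Finset.mem_Icc, Finset.mem_range] at hi ⊢; omega
    rw [← Finset.sum_subset hsub]
    · refine Finset.sum_congr rfl fun i hi => ?_
      have hi := Finset.mem_Icc.1 hi
      have : K - k = (i - k) + (K - i) := by omega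
      rw [this, pow_add, inv_pow]
      field_simp
    · intro i hi hi'
      simp only [Finset.mem_Icc, Finset.mem_range] at hi hi'
      simp [Nat.choose_eq_zero_of_lt (show i < k by omega)]
  rw [waitJudge, hsum]
  ring

lemma waitJudge_eq_zero_iff {k K : ℕ} (hk : k ≤ K) (β : ℝ) {e : ℝ} (he : e < 1) :
    waitJudge k β K e = 0 ↔ β / (K + 1) * judgeSum k K (1 - e)⁻¹ = K.choose k := by
  rw [waitJudge_eq_mul hk β he, mul_eq_zero, sub_eq_zero, or_iff_right]
  exact pow_ne_zero _ (by linarith)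

lemma judgeSum_lt {k K : ℕ} (hk : k < K) {u v : ℝ} (hu : 0 ≤ u) (huv : u < v) :
    judgeSum k K u < judgeSum k K v := by
  refine Finset.sum_lt_sum (fun i _ => by gcongr) ⟨k, Finset.mem_range.2 (by omega), ?_⟩
  have := pow_lt_pow_left₀ huv hu (show K - k ≠ 0 by omega)
  simpa using this

/-- After normalisation by `K.choose k`, the sums decrease in `k`; this makes the solutions of the
wait-and-judge equation increase with `k`. -/
lemma judgeSum_succ_mul_le {k K : ℕ} {u : ℝ} (hu : 0 ≤ u) :
    judgeSum (k + 1) K u * K.choose k ≤ judgeSum k K u * K.choose (k + 1) := by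
  rw [judgeSum, judgeSum, Finset.sum_mul, Finset.sum_mul]
  refine Finset.sum_le_sum fun i hi => ?_
  have hi : i ≤ K := by simpa [Nat.lt_succ_iff] using hi
  have key : i.choose (k + 1) * K.choose k ≤ i.choose k * K.choose (k + 1) := by
    refine Nat.le_of_mul_le_mul_right (c := k + 1) ?_ (Nat.succ_pos k)
    calc i.choose (k + 1) * K.choose k * (k + 1) = (i.choose (k + 1) * (k + 1)) * K.choose k := by
          ring
      _ = i.choose k * K.choose k * (i - k) := by rw [Nat.choose_succ_right_eq]; ring
      _ ≤ i.choose k * K.choose k * (K - k) := by gcongr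
      _ = i.choose k * (K.choose (k + 1) * (k + 1)) := by rw [Nat.choose_succ_right_eq]; ring
      _ = _ := by ring
  have key' : (i.choose (k + 1) : ℝ) * K.choose k ≤ i.choose k * K.choose (k + 1) := by
    exact_mod_cast key
  calc _ = (i.choose (k + 1) : ℝ) * K.choose k * u ^ (K - i) := by ring
    _ ≤ (i.choose k : ℝ) * K.choose (k + 1) * u ^ (K - i) := by gcongr
    _ = _ := by ring

theorem existsUnique_waitJudge_eq_zero {k K : ℕ} (hk : k < K) {β : ℝ}
    (hβ : β ∈ Set.Ioo (0 : ℝ) 1) : ∃! e : ℝ, e ∈ Set.Ioo (0 : ℝ) 1 ∧ waitJudge k β K e = 0 := by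
  have hK : (0 : ℝ) < K + 1 := by positivity
  have hc : Continuous (waitJudge k β K) := by unfold waitJudge; fun_prop
  have h0 : waitJudge k β K 0 < 0 := by
    have h1 : (∑ i ∈ Finset.Icc k K, (i.choose k : ℝ) * (1 - 0) ^ (i - k))
        = ((K + 1).choose (k + 1) : ℕ) := by
      rw [← Nat.sum_Icc_choose]; simp
    have h2 : ((K : ℝ) + 1) * K.choose k = ((K + 1).choose (k + 1) : ℕ) * (k + 1) := by
      exact_mod_cast Nat.add_one_mul_choose_eq K k
    have h3 : (0 : ℝ) < K.choose k := by exact_mod_cast Nat.choose_pos hk.le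
    have h4 : (((K + 1).choose (k + 1) : ℕ) : ℝ) ≤ (K + 1) * K.choose k := by
      rw [h2]
      exact le_mul_of_one_le_right (by positivity) (by linarith [Nat.cast_nonneg (α := ℝ) k])
    rw [waitJudge, h1]
    have h5 : β / (K + 1) * ((K + 1).choose (k + 1) : ℕ) ≤ β * K.choose k := by
      calc _ ≤ β / (K + 1) * ((K + 1) * K.choose k) :=
            mul_le_mul_of_nonneg_left h4 (div_nonneg hβ.1.le hK.le)
        _ = _ := by field_simp
    simp only [sub_zero, one_pow, mul_one]
    nlinarith [hβ.2]
  have h1 : 0 < waitJudge k β K 1 := by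
    have : (∑ i ∈ Finset.Icc k K, (i.choose k : ℝ) * (1 - 1) ^ (i - k)) = 1 := by
      rw [Finset.sum_eq_single_of_mem k (by simp [hk.le])]
      · simp
      · intro i hi hik
        have := Finset.mem_Icc.1 hi
        simp [show i - k ≠ 0 by omega]
    rw [waitJudge, this, sub_self, zero_pow (by omega)]
    simpa using div_pos hβ.1 hK
  obtain ⟨e, he, hez⟩ := intermediate_value_Ioo zero_le_one hc.continuousOn ⟨h0, h1⟩
  -- Two solutions `a < b` would contradict the strict monotonicity of `judgeSum` in `(1 - e)⁻¹`.
  have key : ∀ a b : ℝ, b < 1 → waitJudge k β K a = 0 → waitJudge k β K b = 0 → ¬ a < b := by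
    intro a b hb ha0 hb0 hab
    rw [waitJudge_eq_zero_iff hk.le β (hab.trans hb)] at ha0
    rw [waitJudge_eq_zero_iff hk.le β hb] at hb0
    have hlt := judgeSum_lt hk (u := (1 - a)⁻¹) (v := (1 - b)⁻¹)
      (inv_nonneg.2 (by linarith)) (by gcongr)
    have := mul_lt_mul_of_pos_left hlt (div_pos hβ.1 hK)
    linarith
  refine ⟨e, ⟨he, hez⟩, fun e' he' => ?_⟩
  exact le_antisymm (not_lt.1 (key _ _ he'.1.2 hez he'.2)) (not_lt.1 (key _ _ he.2 he'.2 hez))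

theorem waitJudge_root_mono {K : ℕ} {β : ℝ} (hβ : 0 < β) {ε : ℕ → ℝ}
    (hε : ∀ k < K, ε k ∈ Set.Ioo (0 : ℝ) 1 ∧ waitJudge k β K (ε k) = 0)
    {k l : ℕ} (hkl : k ≤ l) (hl : l < K) : ε k ≤ ε l := by
  induction l, hkl using Nat.le_induction with
  | base => exact le_rfl
  | succ l hkl ih =>
    refine (ih (by omega)).trans ?_
    obtain ⟨h1, h2⟩ := hε l (by omega)
    obtain ⟨h3, h4⟩ := hε (l + 1) hl
    rw [waitJudge_eq_zero_iff (by omega) β h1.2] at h2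
    rw [waitJudge_eq_zero_iff (by omega) β h3.2] at h4
    by_contra! hlt
    have hB : (0 : ℝ) < β / (K + 1) := by positivity
    have hc1 : (0 : ℝ) < K.choose (l + 1) := by exact_mod_cast Nat.choose_pos hl.le
    have a := judgeSum_lt (show l < K by omega) (u := (1 - ε (l + 1))⁻¹) (v := (1 - ε l)⁻¹)
      (inv_nonneg.2 (by linarith [h3.2])) (by gcongr; linarith [h1.2])
    have b := judgeSum_succ_mul_le (k := l) (K := K) (u := (1 - ε (l + 1))⁻¹)
      (inv_nonneg.2 (by linarith [h3.2]))
    have c := mul_lt_mul_of_pos_right a hc1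
    rw [← h4, ← h2] at b
    rw [← h4] at c
    nlinarith [mul_lt_mul_of_pos_left a hB]

/-! ### Double counting of sub-samples -/

lemma sum_superset_card {K : ℕ} (J : Finset (Fin K)) (g : ℕ → ℝ) :
    ∑ A with J ⊆ A, g A.card =
      ∑ j ∈ Finset.range (K - J.card + 1), ((K - J.card).choose j : ℝ) * g (J.card + j) := by
  have h1 : (Finset.univ.filter fun A => J ⊆ A) = (Jᶜ).powerset.image (J ∪ ·) := by
    rw [Finset.compl_eq_univ_sdiff, ← Finset.Icc_eq_image_powerset (Finset.subset_univ J)]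
    ext A; simp
  have hd : ∀ C ∈ (Jᶜ).powerset, Disjoint J C := fun C hC =>
    Finset.disjoint_left.2 fun a ha hb => by simpa [ha] using Finset.mem_powerset.1 hC hb
  rw [h1, Finset.sum_image]
  · have h2 : ∀ C ∈ (Jᶜ).powerset, g (J ∪ C).card = (fun j => g (J.card + j)) C.card := by
      intro C hC
      rw [Finset.card_union_of_disjoint (hd C hC)]
    rw [Finset.sum_congr rfl h2, Finset.sum_powerset_apply_card (fun j => g (J.card + j)),
      Finset.card_compl, Fintype.card_fin]
    simp
  · intro C hC D hD h
    have := congrArg (· \ J) h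
    simpa [Finset.union_sdiff_cancel_left (hd C hC), Finset.union_sdiff_cancel_left (hd D hD)]
      using this

/-- By `(K - k).choose j / K.choose (k + j) = (k + j).choose k / K.choose k` with `k = J.card`,
averaging over the supersets of `J` produces the coefficients of the wait-and-judge equation. -/
lemma sum_superset_inv_choose {K : ℕ} (J : Finset (Fin K)) (u : ℝ) :
    ∑ A with J ⊆ A, u ^ (K - A.card) / (K.choose A.card : ℝ) =
      judgeSum J.card K u / K.choose J.card := by
  have hJ : J.card ≤ K := by simpa using J.card_le_univ
  rw [sum_superset_card J (fun m => u ^ (K - m) / (K.choose m : ℝ)), judgeSum, Finset.sum_div]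
  have hsplit : K + 1 = J.card + (K - J.card + 1) := by omega
  rw [hsplit, Finset.sum_range_add (n := J.card), Finset.sum_eq_zero (s := Finset.range J.card),
    zero_add]
  · refine Finset.sum_congr rfl fun j hj => ?_
    have hj : j < K - J.card + 1 := Finset.mem_range.1 hj
    have h1 : (K.choose (J.card + j) : ℝ) ≠ 0 := by
      exact_mod_cast (Nat.choose_pos (by omega)).ne'
    have h2 : (K.choose J.card : ℝ) ≠ 0 := by exact_mod_cast (Nat.choose_pos hJ).ne'
    have h3 : (K.choose (J.card + j) : ℝ) * (J.card + j).choose J.card =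
        K.choose J.card * (K - J.card).choose j := by
      have := Nat.choose_mul (n := K) (k := J.card + j) (s := J.card) (by omega)
      rw [Nat.add_sub_cancel_left] at this
      exact_mod_cast this
    rw [mul_div_assoc', div_eq_div_iff h1 h2]
    linear_combination (-(u ^ (K - (J.card + j)))) * h3
  · intro i hi
    simp [Nat.choose_eq_zero_of_lt (Finset.mem_range.1 hi)]

lemma sum_inv_choose_card (K : ℕ) :
    ∑ A : Finset (Fin K), (1 : ℝ) / (K.choose A.card : ℝ) = K + 1 := by
  have h := sum_superset_inv_choose (∅ : Finset (Fin K)) 1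
  simp only [Finset.empty_subset, Finset.filter_true, one_pow] at h
  rw [h]
  simp [judgeSum]

/-- The dual certificate behind the wait-and-judge bound: nonnegative weights `E J A` with total
mass at most one on the subsets of every `A`, which decay at least geometrically with ratio
`1 - ε` as `A` grows, have total mass at most `β` at `A = univ`. The constraint for `A` is used
with the multiplier `1 / ((K + 1) * K.choose A.card)`. -/
theorem sum_le_of_geometric_decay {K : ℕ} {β : ℝ} (hβ : 0 < β) {ε : ℕ → ℝ}
    (hε : ∀ k < K, ε k ∈ Set.Ioo (0 : ℝ) 1 ∧ waitJudge k β K (ε k) = 0)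
    {E : Finset (Fin K) → Finset (Fin K) → ℝ} (hE : ∀ J A, 0 ≤ E J A)
    (hsum : ∀ A, ∑ J ∈ A.powerset, E J A ≤ 1)
    (hdecay : ∀ J A, J ⊆ A → J.card < K →
      E J Finset.univ ≤ (1 - ε J.card) ^ (K - A.card) * E J A) :
    ∑ J with J.card < K, E J Finset.univ ≤ β := by
  have hK : (0 : ℝ) < K + 1 := by positivity
  have hone : ∀ J : Finset (Fin K), J.card < K →
      E J Finset.univ * ((K + 1) / β) ≤ ∑ A with J ⊆ A, E J A / (K.choose A.card : ℝ) := by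
    intro J hJ
    obtain ⟨h1, h2⟩ := hε _ hJ
    rw [waitJudge_eq_zero_iff hJ.le β h1.2] at h2
    have hc : (0 : ℝ) < K.choose J.card := by exact_mod_cast Nat.choose_pos hJ.le
    have h3 : (K + 1) / β = judgeSum J.card K (1 - ε J.card)⁻¹ / K.choose J.card := by
      rw [div_eq_div_iff hβ.ne' hc.ne', ← h2]
      field_simp
    rw [h3, ← sum_superset_inv_choose, Finset.mul_sum]
    refine Finset.sum_le_sum fun A hA => ?_
    have hA : J ⊆ A := by simpa using hA
    have hpos : (0 : ℝ) < (1 - ε J.card) ^ (K - A.card) := pow_pos (by linarith [h1.2]) _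
    rw [← mul_div_assoc]
    gcongr
    rw [inv_pow, ← div_eq_mul_inv, div_le_iff₀ hpos, mul_comm]
    exact hdecay J A hA hJ
  have htot : (∑ J with J.card < K, E J Finset.univ) * ((K + 1) / β) ≤ K + 1 := by
    calc _ ≤ ∑ J with J.card < K, ∑ A with J ⊆ A, E J A / (K.choose A.card : ℝ) := by
          rw [Finset.sum_mul]
          exact Finset.sum_le_sum fun J hJ => hone J (Finset.mem_filter.1 hJ).2
      _ ≤ ∑ J, ∑ A with J ⊆ A, E J A / (K.choose A.card : ℝ) :=
          Finset.sum_le_sum_of_subset_of_nonneg (Finset.filter_subset _ _) fun J _ _ =>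
            Finset.sum_nonneg fun A _ => div_nonneg (hE J A) (Nat.cast_nonneg _)
      _ = ∑ A, ∑ J ∈ A.powerset, E J A / (K.choose A.card : ℝ) :=
          Finset.sum_comm' (by simp)
      _ ≤ ∑ A : Finset (Fin K), (1 : ℝ) / (K.choose A.card : ℝ) := by
          refine Finset.sum_le_sum fun A _ => ?_
          rw [← Finset.sum_div]
          gcongr
          exact hsum A
      _ = K + 1 := sum_inv_choose_card K
  rw [mul_div_assoc', div_le_iff₀ hβ, mul_comm] at htot
  exact le_of_mul_le_mul_left htot hK

/-! ### Minimal invariant sub-samples -/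

section Invariant

variable {Δ : Type*} {K : ℕ}

open Classical in
/-- The sub-samples `J ⊆ A` of smallest cardinality on which the set function `f` takes the same
value as on the sample indexed by `A`. -/
noncomputable def minInvariant (f : Set Δ → EReal) (ω : Fin K → Δ) (A : Finset (Fin K)) :
    Finset (Finset (Fin K)) :=
  A.powerset.filter fun J => f (ω '' J) = f (ω '' A) ∧
    ∀ J' ∈ A.powerset, f (ω '' J') = f (ω '' A) → J.card ≤ J'.card

open Classical in
/-- The unit mass of a sample `A`, spread evenly over its minimal invariant sub-samples. -/
noncomputable def share (f : Set Δ → EReal) (J A : Finset (Fin K)) (ω : Fin K → Δ) : ENNReal :=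
  if J ∈ minInvariant f ω A then ((minInvariant f ω A).card : ENNReal)⁻¹ else 0

lemma mem_minInvariant {f : Set Δ → EReal} {ω : Fin K → Δ} {A J : Finset (Fin K)} :
    J ∈ minInvariant f ω A ↔ J ⊆ A ∧ f (ω '' J) = f (ω '' A) ∧
      ∀ J' ⊆ A, f (ω '' J') = f (ω '' A) → J.card ≤ J'.card := by
  simp [minInvariant]

lemma minInvariant_nonempty (f : Set Δ → EReal) (ω : Fin K → Δ) (A : Finset (Fin K)) :
    (minInvariant f ω A).Nonempty := by
  classical
  obtain ⟨J, hJ, hmin⟩ := Finset.exists_min_image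
    (A.powerset.filter fun J : Finset (Fin K) => f (ω '' J) = f (ω '' A)) Finset.card
    ⟨A, by simp⟩
  simp only [Finset.mem_filter, Finset.mem_powerset] at hJ hmin
  exact ⟨J, mem_minInvariant.2 ⟨hJ.1, hJ.2, fun J' h h' => hmin J' ⟨h, h'⟩⟩⟩

lemma sum_share (f : Set Δ → EReal) (A : Finset (Fin K)) (ω : Fin K → Δ) :
    ∑ J ∈ A.powerset, share f J A ω = 1 := by
  classical
  have h : (A.powerset.filter fun J => J ∈ minInvariant f ω A) = minInvariant f ω A := by
    ext J
    simp only [Finset.mem_filter, Finset.mem_powerset, and_iff_right_iff_imp]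
    exact fun hJ => (mem_minInvariant.1 hJ).1
  simp only [share]
  rw [← Finset.sum_filter, h, Finset.sum_const, nsmul_eq_mul]
  refine ENNReal.mul_inv_cancel ?_ (ENNReal.natCast_ne_top _)
  exact_mod_cast (Finset.card_pos.2 (minInvariant_nonempty f ω A)).ne'

lemma share_congr (f : Set Δ → EReal) {J A : Finset (Fin K)} {ω ω' : Fin K → Δ}
    (h : ∀ j ∈ A, ω j = ω' j) : share f J A ω = share f J A ω' := by
  have hi : ∀ B ⊆ A, ω '' B = ω' '' B := fun B hB => Set.image_congr fun j hj => h j (hB hj)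
  have : minInvariant f ω A = minInvariant f ω' A := by
    ext B
    simp only [mem_minInvariant]
    refine and_congr_right fun hB => ?_
    rw [hi B hB, hi A subset_rfl]
    refine and_congr_right fun _ => forall₂_congr fun C hC => ?_
    rw [hi C hC]
  rw [share, share, this]

/-- When the sample `A` grows by the point with index `i`, the share of `J` does not increase, and
it is lost if the new point changes the value of `f` on `J`. -/
lemma share_insert_le {f : Set Δ → EReal} (hf : Monotone f) {J A : Finset (Fin K)} (hJ : J ⊆ A)
    (i : Fin K) (ω : Fin K → Δ) :
    share f J (insert i A) ω ≤
      share f J A ω * {z | f (insert z (ω '' J)) = f (ω '' J)}.indicator 1 (ω i) := by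
  classical
  by_cases hJM : J ∈ minInvariant f ω (insert i A)
  swap
  · simp [share, hJM]
  obtain ⟨-, hval, hmin⟩ := mem_minInvariant.1 hJM
  have hAi : A ⊆ insert i A := Finset.subset_insert i A
  have himg : ∀ {B C : Finset (Fin K)}, B ⊆ C → f (ω '' B) ≤ f (ω '' C) := fun h =>
    hf (Set.image_mono (by exact_mod_cast h))
  have hA : f (ω '' A) = f (ω '' (insert i A : Finset (Fin K))) :=
    le_antisymm (himg hAi) (hval ▸ himg hJ)
  have hins : f (insert (ω i) (ω '' J)) = f (ω '' J) := by
    refine le_antisymm ?_ (hf (Set.subset_insert _ _))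
    rw [hval]
    refine hf ?_
    rw [Finset.coe_insert, Set.image_insert_eq]
    exact Set.insert_subset_insert (Set.image_mono (by exact_mod_cast hJ))
  -- The number of competitors of `J` can only grow with the sample.
  have hsub : minInvariant f ω A ⊆ minInvariant f ω (insert i A) := by
    intro B hB
    obtain ⟨h1, h2, h3⟩ := mem_minInvariant.1 hB
    refine mem_minInvariant.2 ⟨h1.trans hAi, h2.trans hA, fun C hC hC' => ?_⟩
    exact (h3 J hJ (hval.trans hA.symm)).trans (hmin C hC hC')
  have hJA : J ∈ minInvariant f ω A :=
    mem_minInvariant.2 ⟨hJ, hval.trans hA.symm, fun C hC hC' =>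
      hmin C (hC.trans hAi) (hC'.trans hA)⟩
  rw [Set.indicator_of_mem (show ω i ∈ {z | f (insert z (ω '' J)) = f (ω '' J)} from hins)]
  simp only [share, hJM, hJA, if_true, Pi.one_apply, mul_one]
  exact ENNReal.inv_le_inv.2 (by exact_mod_cast Finset.card_le_card hsub)

lemma image_update_insert {i : Fin K} {J : Finset (Fin K)} (hi : i ∉ J) (ω : Fin K → Δ) (z : Δ) :
    Function.update ω i z '' (insert i J : Finset (Fin K)) = insert z (ω '' J) := by
  rw [Finset.coe_insert, Set.image_insert_eq, Function.update_self]
  congr 1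
  refine Set.image_congr fun j hj => Function.update_of_ne ?_ _ _
  rintro rfl
  exact hi hj

variable [MeasurableSpace Δ]

lemma measurable_share {f : Set Δ → EReal}
    (hf : ∀ J : Finset (Fin K), Measurable fun ω : Fin K → Δ => f (ω '' J))
    (J A : Finset (Fin K)) : Measurable (share f J A) := by
  classical
  have hset : ∀ B, MeasurableSet {ω : Fin K → Δ | B ∈ minInvariant f ω A} := by
    intro B
    have h := (MeasurableSet.const (α := Fin K → Δ) (B ⊆ A)).inter
      ((measurableSet_eq_fun (hf B) (hf A)).inter (MeasurableSet.iInter fun C : Finset (Fin K) =>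
        MeasurableSet.iInter fun _ : C ⊆ A => (measurableSet_eq_fun (hf C) (hf A)).imp
          (MeasurableSet.const (B.card ≤ C.card))))
    convert h using 1
    ext ω
    simp [mem_minInvariant]
  have hcard : (fun ω : Fin K → Δ => ((minInvariant f ω A).card : ENNReal)) =
      fun ω => ∑ B, if B ∈ minInvariant f ω A then 1 else 0 := by
    ext ω
    simp
  refine Measurable.ite (hset J) (Measurable.inv ?_) measurable_const
  rw [hcard]
  exact Finset.measurable_sum _ fun B _ => Measurable.ite (hset B) measurable_const measurable_const

/-! ### The wait-and-judge bound for monotone set functions -/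

lemma measurable_update_prod (i : Fin K) :
    Measurable fun p : (Fin K → Δ) × Δ => Function.update p.1 i p.2 := by
  refine measurable_pi_lambda _ fun j => ?_
  by_cases h : j = i
  · subst h; simpa using measurable_snd
  · simp only [Function.update_of_ne h]
    exact (measurable_pi_apply j).comp measurable_fst

/-- Replacing one coordinate of a sample by an independent copy preserves its law. -/
lemma measurePreserving_update (μ : Measure Δ) [IsProbabilityMeasure μ] (i : Fin K) :
    MeasurePreserving (fun p : (Fin K → Δ) × Δ => Function.update p.1 i p.2)
      ((Measure.pi fun _ : Fin K => μ).prod μ) (Measure.pi fun _ : Fin K => μ) := by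
  refine ⟨measurable_update_prod i, (Measure.pi_eq fun s hs => ?_).symm⟩
  rw [Measure.map_apply (measurable_update_prod i) (MeasurableSet.univ_pi hs)]
  have : (fun p : (Fin K → Δ) × Δ => Function.update p.1 i p.2) ⁻¹' Set.univ.pi s =
      (Set.univ.pi (Function.update s i Set.univ)) ×ˢ s i := by
    ext p
    simp only [Set.mem_preimage, Set.mem_pi, Set.mem_univ, true_implies, Set.mem_prod]
    constructor
    · refine fun h => ⟨fun j => ?_, by simpa using h i⟩
      by_cases hj : j = i
      · subst hj; simp
      · simpa [Function.update_of_ne hj] using h j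
    · rintro ⟨h, h'⟩ j
      by_cases hj : j = i
      · subst hj; simpa using h'
      · simpa [Function.update_of_ne hj] using h j
  rw [this, Measure.prod_prod, Measure.pi_pi, ← Finset.mul_prod_erase _ _ (Finset.mem_univ i),
    ← Finset.mul_prod_erase _ (fun j => μ (s j)) (Finset.mem_univ i)]
  rw [Function.update_self, measure_univ, one_mul, mul_comm]
  congr 1
  refine Finset.prod_congr rfl fun j hj => ?_
  rw [Function.update_of_ne (Finset.ne_of_mem_erase hj)]

/-- The probability that a new point changes the value of `f` on the sub-sample `J`. -/
noncomputable def changeProb (f : Set Δ → EReal) (μ : Measure Δ) (J : Finset (Fin K))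
    (ω : Fin K → Δ) : ENNReal :=
  μ {z | f (insert z (ω '' J)) ≠ f (ω '' J)}

lemma measurableSet_change {f : Set Δ → EReal}
    (hf : ∀ J : Finset (Fin K), Measurable fun ω : Fin K → Δ => f (ω '' J))
    {i : Fin K} {J : Finset (Fin K)} (hi : i ∉ J) :
    MeasurableSet {p : (Fin K → Δ) × Δ | f (insert p.2 (p.1 '' J)) ≠ f (p.1 '' J)} := by
  have h1 : Measurable fun p : (Fin K → Δ) × Δ => f (insert p.2 (p.1 '' J)) := by
    simpa only [Function.comp_def, image_update_insert hi] using
      (hf (insert i J)).comp (measurable_update_prod i)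
  exact (measurableSet_eq_fun h1 ((hf J).comp measurable_fst)).compl

lemma measurable_changeProb {f : Set Δ → EReal} (μ : Measure Δ) [IsProbabilityMeasure μ]
    (hf : ∀ J : Finset (Fin K), Measurable fun ω : Fin K → Δ => f (ω '' J))
    {i : Fin K} {J : Finset (Fin K)} (hi : i ∉ J) : Measurable (changeProb f μ J) :=
  measurable_measure_prodMk_left (measurableSet_change hf hi)

/-- The share of `J` in `A`, counted only if the change probability of `J` is at least `r`. -/
noncomputable def riskyShare (f : Set Δ → EReal) (μ : Measure Δ) (r : ℝ) (J A : Finset (Fin K))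
    (ω : Fin K → Δ) : ENNReal :=
  {ω | ENNReal.ofReal r ≤ changeProb f μ J ω}.indicator (share f J A) ω

lemma riskyShare_le_share (f : Set Δ → EReal) (μ : Measure Δ) (r : ℝ) (J A : Finset (Fin K))
    (ω : Fin K → Δ) : riskyShare f μ r J A ω ≤ share f J A ω :=
  Set.indicator_le_self _ _ _

lemma measurable_riskyShare {f : Set Δ → EReal} (μ : Measure Δ) [IsProbabilityMeasure μ]
    (hf : ∀ J : Finset (Fin K), Measurable fun ω : Fin K → Δ => f (ω '' J)) (r : ℝ)
    {J : Finset (Fin K)} (hJ : J.card < K) (A : Finset (Fin K)) :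
    Measurable (riskyShare f μ r J A) := by
  obtain ⟨i, hi⟩ : ∃ i, i ∉ J := by
    by_contra! h
    rw [Finset.eq_univ_of_forall h] at hJ
    simp at hJ
  exact (measurable_share hf J A).indicator
    (measurableSet_le measurable_const (measurable_changeProb μ hf hi))

/-- A new sample point keeps a risky share with probability at most `1 - r`: conditionally on the
other points, the share survives only if the new point does not change the value of `f` on `J`. -/
lemma lintegral_riskyShare_insert_le {f : Set Δ → EReal} (hmono : Monotone f) (μ : Measure Δ)
    [IsProbabilityMeasure μ]
    (hf : ∀ J : Finset (Fin K), Measurable fun ω : Fin K → Δ => f (ω '' J)) {r : ℝ} (hr : 0 ≤ r)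
    {i : Fin K} {J A : Finset (Fin K)} (hJA : J ⊆ A) (hi : i ∉ A) (hJ : J.card < K) :
    ∫⁻ ω, riskyShare f μ r J (insert i A) ω ∂(Measure.pi fun _ : Fin K => μ) ≤
      ENNReal.ofReal (1 - r) *
        ∫⁻ ω, riskyShare f μ r J A ω ∂(Measure.pi fun _ : Fin K => μ) := by
  have hiJ : i ∉ J := fun h => hi (hJA h)
  have hm := measurable_riskyShare μ hf r hJ (insert i A)
  rw [← (measurePreserving_update μ i).lintegral_comp hm,
    lintegral_prod (fun p => riskyShare f μ r J (insert i A) (Function.update p.1 i p.2))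
      (hm.comp (measurable_update_prod i)).aemeasurable,
    ← lintegral_const_mul _ (measurable_riskyShare μ hf r hJ A)]
  refine lintegral_mono fun ω => ?_
  have himg : ∀ z, Function.update ω i z '' J = ω '' J := fun z =>
    Set.image_congr fun j hj => Function.update_of_ne (by rintro rfl; exact hiJ hj) _ _
  have hS : MeasurableSet {z | f (insert z (ω '' J)) = f (ω '' J)} := by
    have := (measurableSet_change hf hiJ).compl.preimage (measurable_prodMk_left (x := ω))
    simpa [Set.preimage, Set.compl_def] using this
  have hpt : ∀ z, riskyShare f μ r J (insert i A) (Function.update ω i z) ≤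
      riskyShare f μ r J A ω * {z | f (insert z (ω '' J)) = f (ω '' J)}.indicator 1 z := by
    intro z
    have hc : changeProb f μ J (Function.update ω i z) = changeProb f μ J ω := by
      simp only [changeProb, himg]
    have hs := share_insert_le hmono hJA i (Function.update ω i z)
    rw [himg, Function.update_self, share_congr f (ω' := ω) (A := A) fun j hj =>
      Function.update_of_ne (by rintro rfl; exact hi hj) _ _] at hs
    unfold riskyShare
    by_cases hω : ENNReal.ofReal r ≤ changeProb f μ J ω
    · rw [Set.indicator_of_mem (by simpa [hc] using hω), Set.indicator_of_mem (by simpa using hω)]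
      exact hs
    · rw [Set.indicator_of_notMem (by simpa [hc] using hω)]
      exact zero_le
  calc ∫⁻ z, riskyShare f μ r J (insert i A) (Function.update ω i z) ∂μ
      ≤ ∫⁻ z, riskyShare f μ r J A ω *
          {z | f (insert z (ω '' J)) = f (ω '' J)}.indicator 1 z ∂μ := lintegral_mono hpt
    _ = riskyShare f μ r J A ω * μ {z | f (insert z (ω '' J)) = f (ω '' J)} := by
        rw [lintegral_const_mul _ (measurable_one.indicator hS), lintegral_indicator_one hS]
    _ ≤ ENNReal.ofReal (1 - r) * riskyShare f μ r J A ω := by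
        rw [mul_comm]
        by_cases hω : ENNReal.ofReal r ≤ changeProb f μ J ω
        · gcongr
          have h1 : μ {z | f (insert z (ω '' J)) = f (ω '' J)} = 1 - changeProb f μ J ω := by
            rw [← compl_compl {z | f (insert z (ω '' J)) = f (ω '' J)},
              prob_compl_eq_one_sub hS.compl]
            rfl
          rw [h1, ENNReal.ofReal_sub _ hr, ENNReal.ofReal_one]
          exact tsub_le_tsub_left hω _
        · have h0 : riskyShare f μ r J A ω = 0 := Set.indicator_of_notMem (by simpa using hω) _
          simp [h0]

lemma lintegral_riskyShare_union_le {f : Set Δ → EReal} (hmono : Monotone f) (μ : Measure Δ)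
    [IsProbabilityMeasure μ]
    (hf : ∀ J : Finset (Fin K), Measurable fun ω : Fin K → Δ => f (ω '' J)) {r : ℝ} (hr : 0 ≤ r)
    {J A : Finset (Fin K)} (hJA : J ⊆ A) (hJ : J.card < K) (C : Finset (Fin K)) :
    Disjoint A C →
      ∫⁻ ω, riskyShare f μ r J (A ∪ C) ω ∂(Measure.pi fun _ : Fin K => μ) ≤
        ENNReal.ofReal (1 - r) ^ C.card *
          ∫⁻ ω, riskyShare f μ r J A ω ∂(Measure.pi fun _ : Fin K => μ) := by
  induction C using Finset.induction_on with
  | empty => simp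
  | insert i C hi ih =>
    intro hd
    rw [Finset.disjoint_insert_right] at hd
    rw [Finset.union_insert, Finset.card_insert_of_notMem hi, pow_succ', mul_assoc]
    refine (lintegral_riskyShare_insert_le hmono μ hf hr (hJA.trans Finset.subset_union_left)
      (by simp [hi, hd.1]) hJ).trans ?_
    gcongr
    exact ih hd.2

/-- **Wait-and-judge bound** for a monotone set function `f` of i.i.d. samples: except with
probability `β`, some minimal invariant sub-sample `J` either is the whole sample or has a change
probability below `ε J.card`. -/
theorem measure_minInvariant_risky_le {f : Set Δ → EReal} (hmono : Monotone f) (μ : Measure Δ)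
    [IsProbabilityMeasure μ]
    (hf : ∀ J : Finset (Fin K), Measurable fun ω : Fin K → Δ => f (ω '' J))
    {β : ℝ} (hβ : 0 < β) {ε : ℕ → ℝ}
    (hε : ∀ k < K, ε k ∈ Set.Ioo (0 : ℝ) 1 ∧ waitJudge k β K (ε k) = 0) :
    (Measure.pi fun _ : Fin K => μ) {ω | ∀ J ∈ minInvariant f ω Finset.univ,
      J.card < K ∧ ENNReal.ofReal (ε J.card) ≤ changeProb f μ J ω} ≤ ENNReal.ofReal β := by
  classical
  set P := Measure.pi fun _ : Fin K => μ
  have hle : ∀ J A, ∫⁻ ω, riskyShare f μ (ε J.card) J A ω ∂P ≤ ∫⁻ ω, share f J A ω ∂P :=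
    fun J A => lintegral_mono fun ω => riskyShare_le_share _ _ _ _ _ _
  have hone : ∀ A : Finset (Fin K), ∑ J ∈ A.powerset, ∫⁻ ω, share f J A ω ∂P = 1 := by
    intro A
    rw [← lintegral_finsetSum _ fun J _ => measurable_share hf J A]
    simp [sum_share]
  have hsumle : ∀ A : Finset (Fin K),
      ∑ J ∈ A.powerset, ∫⁻ ω, riskyShare f μ (ε J.card) J A ω ∂P ≤ 1 := fun A =>
    (Finset.sum_le_sum fun J _ => hle J A).trans (hone A).le
  have hzero : ∀ J A : Finset (Fin K), ¬ J ⊆ A → ∀ ω, share f J A ω = 0 := fun J A h ω => by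
    simp [share, mem_minInvariant, h]
  have hfin : ∀ J A, ∫⁻ ω, riskyShare f μ (ε J.card) J A ω ∂P ≠ ⊤ := by
    intro J A
    refine ne_top_of_le_ne_top ENNReal.one_ne_top ((hle J A).trans ?_)
    by_cases h : J ⊆ A
    · rw [← hone A]
      exact Finset.single_le_sum (f := fun J => ∫⁻ ω, share f J A ω ∂P) (fun _ _ => zero_le)
        (Finset.mem_powerset.2 h)
    · simp [hzero J A h]
  have hreal := sum_le_of_geometric_decay hβ hε
    (E := fun J A => (∫⁻ ω, riskyShare f μ (ε J.card) J A ω ∂P).toReal)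
    (fun _ _ => ENNReal.toReal_nonneg)
    (fun A => by
      rw [← ENNReal.toReal_sum fun J _ => hfin J A]
      exact ENNReal.toReal_le_of_le_ofReal zero_le_one (by simpa using hsumle A))
    (fun J A hJA hJ => by
      have h := lintegral_riskyShare_union_le hmono μ hf (hε _ hJ).1.1.le hJA hJ Aᶜ
        disjoint_compl_right
      rw [Finset.union_compl, Finset.card_compl, Fintype.card_fin] at h
      have h2 := ENNReal.toReal_mono
        (ENNReal.mul_ne_top (ENNReal.pow_ne_top ENNReal.ofReal_ne_top) (hfin J A)) h
      rwa [ENNReal.toReal_mul, ENNReal.toReal_pow,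
        ENNReal.toReal_ofReal (by linarith [(hε _ hJ).1.2])] at h2)
  rw [← ENNReal.toReal_sum fun J _ => hfin J _] at hreal
  refine le_trans ?_ ((ENNReal.le_ofReal_iff_toReal_le
    (ENNReal.sum_ne_top.2 fun J _ => hfin J _) hβ.le).2 hreal)
  rw [← lintegral_finsetSum _ fun J hJ =>
    measurable_riskyShare μ hf _ (Finset.mem_filter.1 hJ).2 _]
  -- On the event every minimal invariant `J` is risky, so that the risky shares sum to one.
  refine le_trans (b := ∫⁻ ω in {ω | ∀ J ∈ minInvariant f ω Finset.univ,
      J.card < K ∧ ENNReal.ofReal (ε J.card) ≤ changeProb f μ J ω}, 1 ∂P) (by simp) ?_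
  refine le_trans ?_ (setLIntegral_le_lintegral
    {ω | ∀ J ∈ minInvariant f ω Finset.univ,
      J.card < K ∧ ENNReal.ofReal (ε J.card) ≤ changeProb f μ J ω} _)
  refine setLIntegral_mono (Finset.measurable_sum _ fun J hJ =>
    measurable_riskyShare μ hf _ (Finset.mem_filter.1 hJ).2 _) fun ω hω => ?_
  rw [← sum_share f Finset.univ ω, Finset.powerset_univ, Finset.sum_filter]
  refine Finset.sum_le_sum fun J _ => ?_
  by_cases hJ : J ∈ minInvariant f ω Finset.univ
  · obtain ⟨h1, h2⟩ := hω J hJ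
    rw [if_pos h1, riskyShare, Set.indicator_of_mem (by simpa using h2)]
  · simp [share, hJ]

end Invariant

set_option linter.unusedSectionVars false

/-! ### Attainment of the second-stage minimum -/

variable {N G L : Type*} [Fintype N] [Fintype G] [Fintype L] [DecidableEq N] {H K : ℕ}

/-- The coordinates of an operation other than the voltage angles: `(ch, dis, v, soc, shed)` and
`(gen, flow)`. -/
abbrev Dispatch (N G L : Type*) (H : ℕ) : Type _ :=
  ((N → Fin H → ℝ) × (N → Fin H → ℝ) × (N → Fin H → ℝ) × (N → Fin H → ℝ) × (N → Fin H → ℝ)) ×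
    (G → Fin H → ℝ) × (L → Fin H → ℝ)

/-- The operation with given dispatch and voltage angles. -/
def Dispatch.operation (d : Dispatch N G L H) (θ : N → Fin H → ℝ) : Operation N G L H :=
  ⟨d.1.1, d.1.2.1, d.1.2.2.1, d.1.2.2.2.1, d.1.2.2.2.2, d.2.1, d.2.2, θ⟩

/-- The dispatch of an operation. -/
def Operation.dispatch (y : Operation N G L H) : Dispatch N G L H :=
  ((y.ch, y.dis, y.v, y.soc, y.shed), (y.gen, y.flow))

/-- A pair `(x, γ)` together with auxiliary variables that may witness its feasibility: numbers of
storage units, and a dispatch with voltage angles for each scenario. -/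
abbrev Certificate (N G L : Type*) (H K : ℕ) : Type _ :=
  (Plan N × ℝ) × (N → ℝ) × (Fin K → Dispatch N G L H × (N → Fin H → ℝ))

namespace Network

variable (S : Network N G L H)

lemma continuous_planCost : Continuous S.planCost := by
  unfold planCost; fun_prop

lemma continuous_firstStageCost : Continuous S.firstStageCost := by
  unfold firstStageCost
  cases S.objective
  · exact S.continuous_planCost
  · exact continuous_const

lemma continuous_value : Continuous S.value :=
  (S.continuous_firstStageCost.comp continuous_fst).add (by fun_prop)

lemma operationCost_operation (d : Dispatch N G L H) (θ θ' : N → Fin H → ℝ) :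
    S.operationCost (d.operation θ) = S.operationCost (d.operation θ') := rfl

lemma continuous_operationCost :
    Continuous fun p : Dispatch N G L H × (N → Fin H → ℝ) =>
      S.operationCost (p.1.operation p.2) := by
  unfold operationCost Dispatch.operation
  cases S.objective
  · simp only; fun_prop
  · simp only; fun_prop

lemma isClosed_storageFeasible :
    IsClosed {p : Plan N × Dispatch N G L H × (N → Fin H → ℝ) |
      S.StorageFeasible p.1 (p.2.1.operation p.2.2)} := by
  have : {p : Plan N × Dispatch N G L H × (N → Fin H → ℝ) |
      S.StorageFeasible p.1 (p.2.1.operation p.2.2)} = {p |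
      (∀ n, ∀ t t' : Fin H, (t : ℕ) + 1 = (t' : ℕ) → p.2.1.1.2.2.2.1 n t' - p.2.1.1.2.2.2.1 n t =
        p.2.1.1.1 n t' * S.effCh n - p.2.1.1.2.1 n t' / S.effDis n) ∧
      (∀ n t, 0 ≤ p.2.1.1.1 n t ∧ p.2.1.1.1 n t ≤ p.1.2 n * p.2.1.1.2.2.1 n t) ∧
      (∀ n t, 0 ≤ p.2.1.1.2.1 n t ∧ p.2.1.1.2.1 n t ≤ p.1.2 n * (1 - p.2.1.1.2.2.1 n t)) ∧
      (∀ n t, 0 ≤ p.2.1.1.2.2.2.1 n t ∧ p.2.1.1.2.2.2.1 n t ≤ p.1.1 n) ∧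
      (∀ n t, 0 ≤ p.2.1.1.2.2.1 n t ∧ p.2.1.1.2.2.1 n t ≤ 1)} := by
    ext p
    exact ⟨fun h => ⟨h.1, h.2, h.3, h.4, h.5⟩, fun h => ⟨h.1, h.2.1, h.2.2.1, h.2.2.2.1, h.2.2.2.2⟩⟩
  rw [this]
  simp only [Set.ofPred_and, Set.ofPred_forall]
  refine .inter ?_ (.inter ?_ (.inter ?_ (.inter ?_ ?_)))
  · refine isClosed_iInter fun n => isClosed_iInter fun t => isClosed_iInter fun t' =>
      isClosed_iInter fun _ => isClosed_eq (by fun_prop) (by fun_prop)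
  all_goals
    refine isClosed_iInter fun n => isClosed_iInter fun t => .inter ?_ ?_ <;>
    exact isClosed_le (by fun_prop) (by fun_prop)

lemma isClosed_gridFeasible :
    IsClosed {p : Scenario N H × Dispatch N G L H × (N → Fin H → ℝ) |
      S.GridFeasible p.1 (p.2.1.operation p.2.2)} := by
  have : {p : Scenario N H × Dispatch N G L H × (N → Fin H → ℝ) |
      S.GridFeasible p.1 (p.2.1.operation p.2.2)} = {p |
      (∀ n t, (∑ i with S.genBus i = n, p.2.1.2.1 i t) + p.2.1.1.2.1 n t - p.2.1.1.1 n t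
        + p.1.1 n t * S.windCap n + (∑ l with S.recvBus l = n, p.2.1.2.2 l t)
        - (∑ l with S.sendBus l = n, p.2.1.2.2 l t) + p.2.1.1.2.2.2.2 n t =
          p.1.2 n t * S.peakLoad n) ∧
      (∀ i t, S.genMin i ≤ p.2.1.2.1 i t ∧ p.2.1.2.1 i t ≤ S.genMax i) ∧
      (∀ i, ∀ t t' : Fin H, (t : ℕ) + 1 = (t' : ℕ) →
        -S.rampDown i ≤ p.2.1.2.1 i t' - p.2.1.2.1 i t ∧
          p.2.1.2.1 i t' - p.2.1.2.1 i t ≤ S.rampUp i) ∧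
      (∀ l t, S.flowMin l ≤ p.2.1.2.2 l t ∧ p.2.1.2.2 l t ≤ S.flowMax l) ∧
      (∀ n t, 0 ≤ p.2.1.1.2.2.2.2 n t ∧ p.2.1.1.2.2.2.2 n t ≤ p.1.2 n t * S.peakLoad n) ∧
      (∀ l t, p.2.1.2.2 l t =
        1 / S.reactance l * (p.2.2 (S.sendBus l) t - p.2.2 (S.recvBus l) t))} := by
    ext p
    exact ⟨fun h => ⟨h.1, h.2, h.3, h.4, h.5, h.6⟩,
      fun h => ⟨h.1, h.2.1, h.2.2.1, h.2.2.2.1, h.2.2.2.2.1, h.2.2.2.2.2⟩⟩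
  rw [this]
  simp only [Set.ofPred_and, Set.ofPred_forall]
  refine .inter ?_ (.inter ?_ (.inter ?_ (.inter ?_ (.inter ?_ ?_))))
  · exact isClosed_iInter fun n => isClosed_iInter fun t => isClosed_eq (by fun_prop) (by fun_prop)
  · exact isClosed_iInter fun n => isClosed_iInter fun t =>
      (isClosed_le (by fun_prop) (by fun_prop)).inter (isClosed_le (by fun_prop) (by fun_prop))
  · exact isClosed_iInter fun n => isClosed_iInter fun t => isClosed_iInter fun t' =>
      isClosed_iInter fun _ =>
      (isClosed_le (by fun_prop) (by fun_prop)).inter (isClosed_le (by fun_prop) (by fun_prop))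
  · exact isClosed_iInter fun n => isClosed_iInter fun t =>
      (isClosed_le (by fun_prop) (by fun_prop)).inter (isClosed_le (by fun_prop) (by fun_prop))
  · exact isClosed_iInter fun n => isClosed_iInter fun t =>
      (isClosed_le (by fun_prop) (by fun_prop)).inter (isClosed_le (by fun_prop) (by fun_prop))
  · exact isClosed_iInter fun n => isClosed_iInter fun t => isClosed_eq (by fun_prop) (by fun_prop)

/-- The line flows under DC power flow, as a linear function of the voltage angles. -/
noncomputable def flowMap : (N → Fin H → ℝ) →ₗ[ℝ] (L → Fin H → ℝ) where
  toFun θ l t := 1 / S.reactance l * (θ (S.sendBus l) t - θ (S.recvBus l) t)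
  map_add' θ θ' := by ext l t; simp; ring
  map_smul' c θ := by ext l t; simp; ring

/-- A continuous choice of voltage angles that produce given flows, where these are possible. -/
lemma exists_continuous_angle :
    ∃ g : (L → Fin H → ℝ) → (N → Fin H → ℝ), Continuous g ∧
      ∀ θ, S.flowMap (g (S.flowMap θ)) = S.flowMap θ := by
  obtain ⟨g₀, hg₀⟩ := S.flowMap (H := H).rangeRestrict.exists_rightInverse_of_surjective
    (LinearMap.range_rangeRestrict _)
  obtain ⟨g, hg⟩ := LinearMap.exists_extend g₀
  refine ⟨g, g.continuous_of_finiteDimensional, fun θ => ?_⟩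
  have h1 := LinearMap.congr_fun hg (S.flowMap.rangeRestrict θ)
  have h2 := LinearMap.congr_fun hg₀ (S.flowMap.rangeRestrict θ)
  have h3 := congrArg Subtype.val h2
  simp only [LinearMap.comp_apply, Submodule.subtype_apply] at h1 h3
  rw [← h1] at h3
  simpa using h3

/-- The dispatches of feasible operations form a compact set: the voltage angles are unbounded, but
they can be replaced by a continuous function of the line flows. -/
lemma isCompact_dispatch (x : Plan N) (δ : Scenario N H) :
    IsCompact {d : Dispatch N G L H | ∃ θ, d.operation θ ∈ S.secondStage x δ} := by
  obtain ⟨g, hg, hgS⟩ := S.exists_continuous_angle (H := H)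
  have heq : {d : Dispatch N G L H | ∃ θ, d.operation θ ∈ S.secondStage x δ} =
      {d | d.operation (g d.2.2) ∈ S.secondStage x δ} := by
    ext d
    refine ⟨fun ⟨θ, h1, h2⟩ => ⟨⟨h1.1, h1.2, h1.3, h1.4, h1.5⟩,
      ⟨h2.1, h2.2, h2.3, h2.4, h2.5, fun l t => ?_⟩⟩, fun h => ⟨_, h⟩⟩
    -- Only `dcFlow` involves the angles, and `g` reproduces every flow in the range of `flowMap`.
    have hθ : d.2.2 = S.flowMap θ := by
      ext l t
      exact h2.dcFlow l t
    have := hgS θ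
    rw [← hθ] at this
    exact (congrFun (congrFun this l) t).symm
  have hclosed : IsClosed {d : Dispatch N G L H | d.operation (g d.2.2) ∈ S.secondStage x δ} :=
    (S.isClosed_storageFeasible.preimage
      (f := fun d : Dispatch N G L H => (x, d, g d.2.2)) (by fun_prop)).inter
    (S.isClosed_gridFeasible.preimage
      (f := fun d : Dispatch N G L H => (δ, d, g d.2.2)) (by fun_prop))
  rw [heq]
  refine IsCompact.of_isClosed_subset (isCompact_Icc
    (a := (((fun _ _ => 0, fun _ _ => 0, fun _ _ => 0, fun _ _ => 0, fun _ _ => 0),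
      (fun i _ => S.genMin i, fun l _ => S.flowMin l)) : Dispatch N G L H))
    (b := ((fun n _ => |x.2 n|, fun n _ => |x.2 n|, fun _ _ => 1, fun n _ => x.1 n,
      fun n t => δ.2 n t * S.peakLoad n), (fun i _ => S.genMax i, fun l _ => S.flowMax l))))
    hclosed ?_
  rintro d ⟨h1, h2⟩
  have hP : ∀ (a w : ℝ), 0 ≤ w → w ≤ 1 → a * w ≤ |a| := fun a w h0 h1 => by
    calc a * w ≤ |a| * w := mul_le_mul_of_nonneg_right (le_abs_self a) h0
      _ ≤ |a| := mul_le_of_le_one_right (abs_nonneg a) h1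
  refine ⟨⟨⟨fun n t => (h1.charging n t).1, fun n t => (h1.discharging n t).1,
      fun n t => (h1.relaxed n t).1, fun n t => (h1.socBounds n t).1,
      fun n t => (h2.shedding n t).1⟩,
      ⟨fun i t => (h2.generation i t).1, fun l t => (h2.flowBounds l t).1⟩⟩,
    ⟨⟨fun n t => (h1.charging n t).2.trans ?_, fun n t => (h1.discharging n t).2.trans ?_,
      fun n t => (h1.relaxed n t).2, fun n t => (h1.socBounds n t).2,
      fun n t => (h2.shedding n t).2⟩,
      ⟨fun i t => (h2.generation i t).2, fun l t => (h2.flowBounds l t).2⟩⟩⟩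
  · exact hP _ _ (h1.relaxed n t).1 (h1.relaxed n t).2
  · exact hP _ _ (by linarith [(h1.relaxed n t).2]) (by linarith [(h1.relaxed n t).1])

lemma exists_operation_min {x : Plan N} {δ : Scenario N H} (h : (S.secondStage x δ).Nonempty) :
    ∃ y ∈ S.secondStage x δ, ∀ y' ∈ S.secondStage x δ, S.operationCost y ≤ S.operationCost y' := by
  have hcont : Continuous ((fun p : Dispatch N G L H × (N → Fin H → ℝ) =>
      S.operationCost (p.1.operation p.2)) ∘ fun d => (d, 0)) :=
    S.continuous_operationCost.comp (by fun_prop)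
  have hmem : ∀ y ∈ S.secondStage x δ,
      y.dispatch ∈ {d : Dispatch N G L H | ∃ θ, d.operation θ ∈ S.secondStage x δ} :=
    fun y hy => ⟨y.angle, hy⟩
  have hne : {d : Dispatch N G L H | ∃ θ, d.operation θ ∈ S.secondStage x δ}.Nonempty :=
    h.elim fun y hy => ⟨_, hmem y hy⟩
  obtain ⟨d, hd, hmin⟩ := (S.isCompact_dispatch x δ).exists_isMinOn hne hcont.continuousOn
  obtain ⟨θ, hd⟩ := hd
  refine ⟨d.operation θ, hd, fun y hy => ?_⟩
  have h1 : S.operationCost (d.operation 0) ≤ S.operationCost (y.dispatch.operation 0) :=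
    isMinOn_iff.1 hmin _ (hmem y hy)
  rw [S.operationCost_operation d θ 0]
  refine h1.trans_eq ?_
  rw [S.operationCost_operation y.dispatch 0 y.angle]
  rfl

/-- The inner minimum is attained. -/
theorem recourseCost_le_iff {x : Plan N} {δ : Scenario N H} {γ : ℝ} :
    S.recourseCost x δ ≤ (γ : EReal) ↔ (x, γ) ∈ S.robustSet δ := by
  constructor
  · intro h
    rcases (S.secondStage x δ).eq_empty_or_nonempty with he | hne
    · rw [recourseCost, he] at h
      simp at h
    · obtain ⟨y, hy, hmin⟩ := S.exists_operation_min hne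
      refine ⟨y, hy, EReal.coe_le_coe_iff.1 (le_trans (le_iInf₂ fun y' hy' => ?_) h)⟩
      exact EReal.coe_le_coe_iff.2 (hmin y' hy')
  · rintro ⟨y, hy, hle⟩
    exact (iInf₂_le y hy).trans (EReal.coe_le_coe_iff.2 hle)

lemma worstCost_le_iff {ω : Fin K → Scenario N H} {J : Finset (Fin K)} {x : Plan N} {γ : ℝ} :
    S.worstCost ω J x ≤ (γ : EReal) ↔ ∀ i ∈ J, (x, γ) ∈ S.robustSet (ω i) := by
  simp only [worstCost, iSup_le_iff, recourseCost_le_iff]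

/-! ### The optimal value as a set function of the scenarios -/

/-- The pairs `(x, γ)` that are feasible for the epigraph form of the robust problem with the
scenarios in `D`. -/
def feasible (D : Set (Scenario N H)) : Set (Plan N × ℝ) :=
  {s | s.1 ∈ S.firstStage ∧ ∀ δ ∈ D, s ∈ S.robustSet δ}

/-- The optimal value of the epigraph form of the robust problem with the scenarios in `D`; it
is `⊤` if the problem is infeasible and `⊥` if it is unbounded. -/
noncomputable def optValue (D : Set (Scenario N H)) : EReal :=
  ⨅ s ∈ S.feasible D, (S.value s : EReal)

lemma monotone_optValue : Monotone S.optValue := fun _ _ h =>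
  biInf_mono fun _ hs => ⟨hs.1, fun δ hδ => hs.2 δ (h hδ)⟩

/-- The real number of storage units is the only auxiliary variable of the first stage. -/
lemma exists_isClosed_firstStage :
    ∃ F : Set (Plan N × (N → ℝ)), IsClosed F ∧ ∀ x, x ∈ S.firstStage ↔ ∃ z, (x, z) ∈ F := by
  have h1 : IsClosed {p : Plan N × (N → ℝ) | S.planCost p.1 ≤ S.budget} :=
    isClosed_le (S.continuous_planCost.comp continuous_fst) continuous_const
  have h2 : IsClosed {p : Plan N × (N → ℝ) |
      ∀ n, S.ratioMin * p.1.1 n ≤ p.1.2 n ∧ p.1.2 n ≤ S.ratioMax * p.1.1 n} := by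
    simp only [Set.ofPred_and, Set.ofPred_forall]
    exact isClosed_iInter fun n =>
      (isClosed_le (by fun_prop) (by fun_prop)).inter (isClosed_le (by fun_prop) (by fun_prop))
  have h3 : IsClosed {p : Plan N × (N → ℝ) | ∑ n, p.2 n ≤ S.maxUnits ∧
      ∀ n, S.unitE * p.2 n = p.1.1 n ∧ S.unitP * p.2 n = p.1.2 n} := by
    simp only [Set.ofPred_and, Set.ofPred_forall]
    exact (isClosed_le (by fun_prop) (by fun_prop)).inter (isClosed_iInter fun n =>
      (isClosed_eq (by fun_prop) (by fun_prop)).inter (isClosed_eq (by fun_prop) (by fun_prop)))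
  cases hS : S.sizing
  · refine ⟨_, h1.inter h2, fun x => ?_⟩
    simp [firstStage, hS]
  · refine ⟨_, h1.inter (h2.inter h3), fun x => ?_⟩
    simp [firstStage, hS]

set_option synthInstance.maxSize 1000 in
set_option synthInstance.maxHeartbeats 200000 in
/-- The samples for which some feasible pair has value at most `a` form the projection of a closed
subset of a finite-dimensional space, hence a countable union of compact sets. -/
lemma measurableSet_exists_value_le (J : Finset (Fin K)) (a : ℝ) :
    MeasurableSet {ω : Fin K → Scenario N H | ∃ s ∈ S.feasible (ω '' J), S.value s ≤ a} := by
  obtain ⟨F, hF, hFS⟩ := S.exists_isClosed_firstStage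
  let C : Set ((Fin K → Scenario N H) × Certificate N G L H K) :=
    {p | S.value p.2.1 ≤ a} ∩ ({p | (p.2.1.1, p.2.2.1) ∈ F} ∩ ⋂ j ∈ J,
      ({p | S.StorageFeasible p.2.1.1 ((p.2.2.2 j).1.operation (p.2.2.2 j).2)} ∩
      ({p | S.GridFeasible (p.1 j) ((p.2.2.2 j).1.operation (p.2.2.2 j).2)} ∩
      {p | S.operationCost ((p.2.2.2 j).1.operation (p.2.2.2 j).2) ≤ p.2.1.2})))
  have hC : IsClosed C := by
    refine .inter (isClosed_le (S.continuous_value.comp (by fun_prop)) continuous_const)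
      (.inter (hF.preimage
        (f := fun p : (Fin K → Scenario N H) × Certificate N G L H K => (p.2.1.1, p.2.2.1))
        (by fun_prop)) (isClosed_biInter fun j _ => .inter ?_ (.inter ?_ ?_)))
    · exact S.isClosed_storageFeasible.preimage
        (f := fun p : (Fin K → Scenario N H) × Certificate N G L H K => (p.2.1.1, p.2.2.2 j))
        (by fun_prop)
    · exact S.isClosed_gridFeasible.preimage
        (f := fun p : (Fin K → Scenario N H) × Certificate N G L H K => (p.1 j, p.2.2.2 j))
        (by fun_prop)
    · exact isClosed_le (S.continuous_operationCost.comp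
        (f := fun p : (Fin K → Scenario N H) × Certificate N G L H K => p.2.2.2 j)
        (by fun_prop)) (by fun_prop)
  have himg : {ω : Fin K → Scenario N H | ∃ s ∈ S.feasible (ω '' J), S.value s ≤ a} =
      Prod.fst '' C := by
    ext ω
    constructor
    · rintro ⟨s, ⟨hs1, hs2⟩, hsa⟩
      obtain ⟨z, hz⟩ := (hFS _).1 hs1
      have : ∀ j, ∃ y : Operation N G L H,
          j ∈ J → y ∈ S.secondStage s.1 (ω j) ∧ S.operationCost y ≤ s.2 := by
        intro j
        by_cases hj : j ∈ J
        · obtain ⟨y, hy⟩ := hs2 (ω j) (Set.mem_image_of_mem _ hj)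
          exact ⟨y, fun _ => hy⟩
        -- Scenarios outside `J` impose nothing, so any operation serves for them.
        · exact ⟨⟨0, 0, 0, 0, 0, 0, 0, 0⟩, fun h => absurd h hj⟩
      choose y hy using this
      refine ⟨(ω, s, z, fun j => ((y j).dispatch, (y j).angle)), ⟨hsa, hz, ?_⟩, rfl⟩
      exact Set.mem_iInter₂.2 fun j hj => ⟨(hy j hj).1.1, (hy j hj).1.2, (hy j hj).2⟩
    · rintro ⟨⟨ω', s, z, Y⟩, ⟨hsa, hz, hY⟩, rfl⟩
      refine ⟨s, ⟨(hFS _).2 ⟨z, hz⟩, ?_⟩, hsa⟩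
      rintro _ ⟨j, hj, rfl⟩
      obtain ⟨h1, h2, h3⟩ := Set.mem_iInter₂.1 hY j hj
      exact ⟨_, ⟨h1, h2⟩, h3⟩
  rw [himg]
  obtain ⟨Q, hQ, hQC⟩ := (isSigmaCompact_univ.of_isClosed_subset hC (Set.subset_univ _)).image
    continuous_fst
  rw [← hQC]
  exact MeasurableSet.iUnion fun n => (hQ n).measurableSet

lemma measurable_optValue (J : Finset (Fin K)) :
    Measurable fun ω : Fin K → Scenario N H => S.optValue (ω '' J) := by
  refine measurable_of_Iio fun a => ?_
  have : (fun ω : Fin K → Scenario N H => S.optValue (ω '' J)) ⁻¹' Set.Iio a =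
      ⋃ q : ℚ, ⋃ _ : ((q : ℝ) : EReal) < a,
        {ω | ∃ s ∈ S.feasible (ω '' J), S.value s ≤ (q : ℝ)} := by
    ext ω
    simp only [Set.mem_preimage, Set.mem_Iio, optValue, iInf_lt_iff, Set.mem_iUnion]
    constructor
    · rintro ⟨s, hs, hlt⟩
      obtain ⟨q, h1, h2⟩ := EReal.lt_iff_exists_rat_btwn.1 hlt
      exact ⟨q, h2, s, hs, (EReal.coe_lt_coe_iff.1 h1).le⟩
    · rintro ⟨q, hq, s, hs, hle⟩
      exact ⟨s, hs, (EReal.coe_le_coe_iff.2 hle).trans_lt hq⟩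
  rw [this]
  exact MeasurableSet.iUnion fun q => MeasurableSet.iUnion fun _ =>
    S.measurableSet_exists_value_le J q

variable {S} {ω : Fin K → Scenario N H} {J : Finset (Fin K)} {s t : Plan N × ℝ}

lemma mem_feasible_image :
    s ∈ S.feasible (ω '' J) ↔ s.1 ∈ S.firstStage ∧ S.worstCost ω J s.1 ≤ (s.2 : EReal) := by
  rw [worstCost_le_iff]
  simp [feasible]

lemma IsOptimal.mem_feasible (h : S.IsOptimal ω J s) : s ∈ S.feasible (ω '' J) :=
  mem_feasible_image.2 ⟨h.mem, h.worst.le⟩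

lemma IsOptimal.totalCost_eq (h : S.IsOptimal ω J s) : S.totalCost ω J s.1 = S.value s := by
  rw [totalCost, h.worst, value, EReal.coe_add, EReal.coe_mul]

lemma totalCost_le_value (h : t ∈ S.feasible (ω '' J)) : S.totalCost ω J t.1 ≤ S.value t := by
  rw [totalCost, value, EReal.coe_add, EReal.coe_mul]
  gcongr
  · exact_mod_cast S.weight_pos.le
  · exact (mem_feasible_image.1 h).2

lemma IsOptimal.value_le (h : S.IsOptimal ω J s) (ht : t ∈ S.feasible (ω '' J)) :
    S.value s ≤ S.value t := by
  rw [← EReal.coe_le_coe_iff, ← h.totalCost_eq]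
  exact (h.minimal _ ht.1).trans (totalCost_le_value ht)

lemma IsOptimal.optValue_eq (h : S.IsOptimal ω J s) : S.optValue (ω '' J) = S.value s :=
  le_antisymm (iInf₂_le s h.mem_feasible)
    (le_iInf₂ fun _ ht => EReal.coe_le_coe_iff.2 (h.value_le ht))

lemma IsOptimal.of_value_le (h : S.IsOptimal ω J s) (ht : t ∈ S.feasible (ω '' J))
    (hle : S.value t ≤ S.value s) : S.IsOptimal ω J t := by
  have hst : (S.value t : EReal) ≤ S.totalCost ω J t.1 := by
    refine (EReal.coe_le_coe_iff.2 hle).trans ?_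
    rw [← h.totalCost_eq]
    exact h.minimal _ ht.1
  refine ⟨ht.1, ?_, fun x hx => ?_⟩
  · have hw := (mem_feasible_image.1 ht).2
    rw [totalCost] at hst
    generalize S.worstCost ω J t.1 = w at hw hst
    induction w with
    | bot =>
      rw [EReal.coe_mul_bot_of_pos S.weight_pos, EReal.add_bot] at hst
      simp at hst
    | top => simp at hw
    | coe r =>
      rw [← EReal.coe_mul, ← EReal.coe_add, EReal.coe_le_coe_iff, value, add_le_add_iff_left] at hst
      exact congrArg _ (le_antisymm (EReal.coe_le_coe_iff.1 hw)
        (le_of_mul_le_mul_left hst S.weight_pos))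
  · refine (totalCost_le_value ht).trans ((EReal.coe_le_coe_iff.2 hle).trans ?_)
    rw [← h.totalCost_eq]
    exact h.minimal x hx

/-- A sub-sample with the same optimal value as a solvable problem is not empty: without scenarios,
`γ` is unbounded below. -/
lemma IsOptimal.nonempty_of_optValue_eq {A : Finset (Fin K)} (h : S.IsOptimal ω A s)
    (hJ : S.optValue (ω '' J) = S.optValue (ω '' A)) : J.Nonempty := by
  by_contra! hempty
  subst hempty
  have h1 : S.optValue (ω '' (∅ : Finset (Fin K))) ≤ S.value (s.1, s.2 - 1) :=
    iInf₂_le (s.1, s.2 - 1) ⟨h.mem, by simp⟩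
  rw [hJ, h.optValue_eq, EReal.coe_le_coe_iff, value, value] at h1
  nlinarith [S.weight_pos]

/-- If `s` is optimal for all scenarios and `J` has the same optimal value, then the scenarios
that `s` does not cover almost surely change the optimal value of `J`. -/
lemma violationProb_le_changeProb (μ : Measure (Scenario N H)) [IsProbabilityMeasure μ]
    (hs : S.IsOptimal ω Finset.univ s)
    (huniq : ∀ J : Finset (Fin K), J.Nonempty → ∃! s, S.IsOptimal ω J s)
    {i : Fin K} (hi : i ∉ J)
    (hz : ∀ᵐ z ∂μ, ∃ s, S.IsOptimal (Function.update ω i z) (insert i J) s)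
    (hJ : S.optValue (ω '' J) = S.optValue (ω '' (Finset.univ : Finset (Fin K)))) :
    ENNReal.ofReal (S.violationProb μ s) ≤ changeProb S.optValue μ J ω := by
  obtain ⟨s', hs', huniq⟩ := huniq J (hs.nonempty_of_optValue_eq hJ)
  have hval : S.value s = S.value s' := by
    rw [hs'.optValue_eq, hs.optValue_eq] at hJ
    exact_mod_cast hJ.symm
  have hsJ : s ∈ S.feasible (ω '' J) :=
    ⟨hs.mem, fun δ hδ => hs.mem_feasible.2 δ (Set.image_mono (by simp) hδ)⟩
  have hss : s = s' := huniq _ (hs'.of_value_le hsJ hval.le)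
  rw [violationProb, measureReal_def, ENNReal.ofReal_toReal (measure_ne_top _ _), changeProb]
  refine measure_mono_ae ?_
  filter_upwards [hz] with z ⟨t, ht⟩ hviol heq
  refine hviol ?_
  have htf := ht.mem_feasible
  have htv := ht.optValue_eq
  rw [image_update_insert hi] at htf htv
  -- If the value did not change, the optimal pair that covers `z` would be optimal for `J`.
  have htJ : t ∈ S.feasible (ω '' J) := ⟨htf.1, fun δ hδ => htf.2 δ (Set.mem_insert_of_mem _ hδ)⟩
  have hv : S.value t = S.value s' := by
    have : (S.value t : EReal) = S.value s' := by rw [← htv, ← hs'.optValue_eq]; exact heq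
    exact_mod_cast this
  have : t = s := (huniq _ (hs'.of_value_le htJ hv.le)).trans hss.symm
  rw [← this]
  exact htf.2 z (Set.mem_insert _ _)

end Network

end StoragePlanning

theorem mainTheorem2 {N G L : Type*} [Fintype N] [Fintype G] [Fintype L] [DecidableEq N] {H : ℕ}
    (S : StoragePlanning.Network N G L H)
    (μ : Measure (StoragePlanning.Scenario N H)) [IsProbabilityMeasure μ]
    (K : ℕ) (β : ℝ) (hβ : β ∈ Set.Ioo (0 : ℝ) 1)
    (hunique : ∀ᵐ ω ∂(Measure.pi fun _ : Fin K => μ), ∀ J : Finset (Fin K), J.Nonempty →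
      ∃! s : StoragePlanning.Plan N × ℝ, S.IsOptimal ω J s)
    (sol : (Fin K → StoragePlanning.Scenario N H) → StoragePlanning.Plan N × ℝ)
    (hsol : ∀ᵐ ω ∂(Measure.pi fun _ : Fin K => μ), S.IsOptimal ω Finset.univ (sol ω))
    (I : (Fin K → StoragePlanning.Scenario N H) → Finset (Fin K))
    (hI : ∀ᵐ ω ∂(Measure.pi fun _ : Fin K => μ), S.IsInvariant ω (I ω)) :
    (∀ k < K, ∃! e : ℝ, e ∈ Set.Ioo (0 : ℝ) 1 ∧ StoragePlanning.waitJudge k β K e = 0) ∧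
    ∀ ε : ℕ → ℝ,
      (∀ k < K, ε k ∈ Set.Ioo (0 : ℝ) 1 ∧ StoragePlanning.waitJudge k β K (ε k) = 0) →
      (Measure.pi fun _ : Fin K => μ)
        {ω | (I ω).card < K ∧ ε (I ω).card ≤ S.violationProb μ (sol ω)} ≤ ENNReal.ofReal β := by
  refine ⟨fun k hk => StoragePlanning.existsUnique_waitJudge_eq_zero hk hβ, fun ε hε => ?_⟩
  refine le_trans (measure_mono_ae ?_) (StoragePlanning.measure_minInvariant_risky_le
    S.monotone_optValue μ S.measurable_optValue hβ.1 hε)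
  -- Replacing one scenario by a fresh one keeps the law of the sample, so that the problem with the
  -- scenarios of `J` and a fresh one is solvable.
  have hupdate : ∀ᵐ ω ∂(Measure.pi fun _ : Fin K => μ), ∀ i : Fin K, ∀ᵐ z ∂μ,
      ∀ J : Finset (Fin K), J.Nonempty →
        ∃! s : StoragePlanning.Plan N × ℝ, S.IsOptimal (Function.update ω i z) J s :=
    ae_all_iff.2 fun i => Measure.ae_ae_of_ae_prod
      ((StoragePlanning.measurePreserving_update μ i).quasiMeasurePreserving.ae hunique)
  filter_upwards [hunique, hsol, hI, hupdate] with ω huniq hs ⟨t, t', ht, ht', hval⟩ hup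
  rintro ⟨hcard, hviol⟩ J hJ
  obtain ⟨-, hJval, hmin⟩ := StoragePlanning.mem_minInvariant.1 hJ
  have hJI : J.card ≤ (I ω).card := hmin _ (Finset.subset_univ _) (by
    rw [ht.optValue_eq, ht'.optValue_eq, hval])
  have hJK : J.card < K := hJI.trans_lt hcard
  obtain ⟨i, hi⟩ : ∃ i, i ∉ J := by
    by_contra! h
    rw [Finset.eq_univ_of_forall h] at hJK
    simp at hJK
  refine ⟨hJK, le_trans (ENNReal.ofReal_le_ofReal ?_)
    (StoragePlanning.Network.violationProb_le_changeProb μ hs huniq hi ?_ hJval)⟩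
  · exact (StoragePlanning.waitJudge_root_mono hβ.1 hε hJI hcard).trans hviol
  · filter_upwards [hup i] with z hz
    exact (hz _ (Finset.insert_nonempty i J)).exists
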